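/- Let $\mathcal I\subset\mathbb R\setminus\{0\}$ be finite. For $i\in\mathcal I$ let $\lambda_i:[0,\infty)\to[0,\infty)$ be integrable on bounded intervals, and put $\Lambda_i(s,t)=\int_s^t\lambda_i(x)\,dx$ and $\Lambda_i(t)=\Lambda_i(0,t)$. Let $N_i$, $i\in\mathcal I$, be independent non-homogeneous Poisson processes (counting processes, with almost surely non-decreasing right-continuous paths) with rate functions $\lambda_i$, and let $S(t)=\sum_{i\in\mathcal I} i\,N_i(t)$, $t\ge 0$, be the corresponding generalized Skellam process. Let $f\in C^1([0,\infty),[0,\infty))$ be non-decreasing with $f(t)\to\infty$ as $t\to\infty$. (i) Suppose that $\Lambda_i(t)/f(t)\to\mu_i\ge 0$ as $t\to\infty$ for every $i\in\mathcal I$. Then, as $t\to\infty$, $$\frac{S(t)}{f(t)}\longrightarrow\sum_{i\in\mathcal I} i\,\mu_i\quad\text{in probability and in } L^1$$ (in particular every $S(t)$ is integrable). If in addition $\sum_{k=1}^\infty \Lambda_i(k,k+1)/f(k)^2<\infty$ for every $i\in\mathcal I$ (terms with $f(k)=0$, of which there are finitely many, being disregarded), then the convergence also holds almost surely, as $t\to\infty$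 through the real numbers. (ii) Suppose that for every $i\in\mathcal I$ and $t\ge 0$, $\Lambda_i(t)=\mu_i(t)+\sigma_i^2(t)$ with real-valued functions $\mu_i(\cdot)$, $\sigma_i^2(\cdot)$ such that, as $t\to\infty$, $$\frac{\mu_i(t)}{\sqrt{f(t)}}\to\mu_i\in\mathbb R,\qquad \frac{\sigma_i^2(t)}{f(t)}\to\sigma_i^2\ge 0\quad\text{for all } i\in\mathcal I,\qquad \frac{1}{\sqrt{f(t)}}\sum_{i\in\mathcal I} i\,\sigma_i^2(t)\to 0.$$ (The last condition holds in particular if $\sum_{i} i\,\sigma_i^2(t)=0$ for all $t\ge 0$, and it implies $\sum_i i\,\sigma_i^2=0$ for the limits.) Then $S(t)/\sqrt{f(t)}$ converges in distribution, as $t\to\infty$, to the normal law $$\mathcal N\Bigl(\sum_{i\in\mathcal I} i\,\mu_i,\ \sum_{i\in\mathcal I} i^2\sigma_i^2\Bigr).$$ -/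

import Mathlib

open MeasureTheory ProbabilityTheory Filter Topology
open scoped NNReal ENNReal

/-- A rate function: nonnegative on `[0, ∞)` and integrable on every `[0, t]`. -/
structure IsRateFunction (lam : ℝ → ℝ) : Prop where
  nonneg : ∀ t, 0 ≤ t → 0 ≤ lam t
  integrable : ∀ t, 0 ≤ t → IntervalIntegrable lam volume 0 t

/-- The cumulative rate `Λ(s, t) = ∫ₛᵗ lam(x) dx`; `Λ(t)` is `Λ(0, t)`. -/
noncomputable def cumulativeRate (lam : ℝ → ℝ) (s t : ℝ) : ℝ :=
  ∫ x in s..t, lam x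

/-- `N` is a (non-homogeneous) Poisson process with rate function `lam` under `P`: a counting
process that starts at `0`, whose increments are independent, the increment over `[s, t]` being
Poisson distributed with parameter `Λ(s, t)`. -/
structure IsPoissonProcess {Ω : Type*} [MeasurableSpace Ω] (P : Measure Ω)
    (lam : ℝ → ℝ) (N : ℝ≥0 → Ω → ℕ) : Prop where
  isRateFunction : IsRateFunction lam
  measurable : ∀ t, Measurable (N t)
  zero : ∀ᵐ ω ∂P, N 0 ω = 0
  paths : ∀ᵐ ω ∂P, Monotone (fun t => N t ω) ∧
    ∀ t : ℝ≥0, ContinuousWithinAt (fun s => N s ω) (Set.Ici t) t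
  indepIncrements : HasIndepIncrements (fun t ω => (N t ω : ℝ)) P
  increments : ∀ s t : ℝ≥0, s ≤ t →
    HasLaw (fun ω => (N t ω : ℝ) - (N s ω : ℝ))
      ((poissonMeasure (cumulativeRate lam s t).toNNReal).map (fun n : ℕ => (n : ℝ))) P

/-- `S` is a non-homogeneous generalized Skellam process with jump sizes in the finite set
`I ⊆ ℝ ∖ {0}` and rate functions `lam i`, `i ∈ I`: almost surely `S(t) = ∑ i N_i(t)` for all
`t ≥ 0`, where the `N_i` are independent Poisson processes with rate functions `lam i`. The
independence is that of the processes, as random elements of `ℝ≥0 → ℕ`. -/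
def IsGeneralizedSkellamProcess {Ω : Type*} [MeasurableSpace Ω] (P : Measure Ω)
    (I : Finset ℝ) (lam : I → ℝ → ℝ) (S : ℝ≥0 → Ω → ℝ) : Prop :=
  (0 : ℝ) ∉ I ∧
  ∃ N : I → ℝ≥0 → Ω → ℕ,
    (∀ i, IsPoissonProcess P (lam i) (N i)) ∧
    iIndepFun (fun (i : I) (ω : Ω) (t : ℝ≥0) => N i t ω) P ∧
    ∀ᵐ ω ∂P, ∀ t : ℝ≥0, S t ω = ∑ i : I, (i : ℝ) * (N i t ω : ℝ)

/-! Everything rests on $N_i(t)$ being Poisson, with mean and variance both $\Lambda_i(t)$.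

For (i), $\|N_i/f-\Lambda_i/f\|_1\le\sqrt{\Lambda_i}/f\to0$, and $L^1$ convergence implies
convergence in probability. For the almost sure statement integer times do not suffice, since
$\Lambda_i(k,k+1)$ need not be $o(f(k))$. Time is therefore cut at the integers and at further
points, so that $\Lambda_i$ grows by at most 1 on each cell (`IsRateFunction.exists_partition`). The
centred increments, divided essentially by $f$ at the integer part of the left endpoint, have
summable variances, so their series converges by martingale convergence. Kronecker's lemma then
controls $N_i-\Lambda_i$ at the cut points, and monotone paths fill in each cell up to an error of
1.

For (ii), the characteristic function of $S/\sqrt f$ is $\exp\sum_i\Lambda_i(e^{\mathrm{i}xu/\sqrt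
f}-1)$ with jump sizes $x=i$. Expanding to second order, the linear part converges by the balance
condition on $\sum_i i\,\sigma_i^2$, the quadratic part gives the variance, and the remainder
vanishes. Lévy's continuity theorem concludes. -/

section PoissonMoments
open scoped Nat

theorem hasSum_poisson_mul_natCast (r : ℝ≥0) :
    HasSum (fun n : ℕ => Real.exp (-r) * (r : ℝ) ^ n / n ! * (n : ℝ)) r := by
  -- The term $n=0$ vanishes, and $n\,r^n/n!=r\cdot r^{n-1}/(n-1)!$ for $n\ge1$.
  rw [← hasSum_nat_add_iff' 1]
  convert! (hasSum_one_poissonMeasure r).mul_left (r : ℝ) using 1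
  · ext n
    rw [Nat.factorial_succ]
    push_cast
    field_simp
    ring
  · simp

theorem hasSum_poisson_mul_natCast_sq (r : ℝ≥0) :
    HasSum (fun n : ℕ => Real.exp (-r) * (r : ℝ) ^ n / n ! * (n : ℝ) ^ 2) ((r : ℝ) ^ 2 + r) := by
  rw [← hasSum_nat_add_iff' 1]
  convert! ((hasSum_poisson_mul_natCast r).add (hasSum_one_poissonMeasure r)).mul_left (r : ℝ)
    using 1
  · ext n
    rw [Nat.factorial_succ]
    push_cast
    field_simp
    ring
  · simp
    ring

theorem memLp_two_natCast_poissonMeasure (r : ℝ≥0) :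
    MemLp (fun n : ℕ => (n : ℝ)) 2 (poissonMeasure r) := by
  rw [memLp_two_iff_integrable_sq .of_discrete, integrable_poissonMeasure_iff]
  simpa using (hasSum_poisson_mul_natCast_sq r).summable

theorem memLp_two_id_map_cast_poissonMeasure (r : ℝ≥0) :
    MemLp (id : ℝ → ℝ) 2 ((poissonMeasure r).map (fun n : ℕ => (n : ℝ))) :=
  (memLp_map_measure_iff (by fun_prop) .of_discrete).2 (memLp_two_natCast_poissonMeasure r)

theorem integral_id_map_cast_poissonMeasure (r : ℝ≥0) :
    ∫ x : ℝ, x ∂((poissonMeasure r).map (fun n : ℕ => (n : ℝ))) = r := by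
  rw [integral_map .of_discrete (by fun_prop), integral_poissonMeasure]
  simpa using (hasSum_poisson_mul_natCast r).tsum_eq

theorem variance_id_map_cast_poissonMeasure (r : ℝ≥0) :
    Var[id; (poissonMeasure r).map (fun n : ℕ => (n : ℝ))] = r := by
  rw [variance_eq_sub (memLp_two_id_map_cast_poissonMeasure r)]
  have h : ∫ x : ℝ, (id ^ 2 : ℝ → ℝ) x ∂((poissonMeasure r).map (fun n : ℕ => (n : ℝ))) =
      (r : ℝ) ^ 2 + r := by
    rw [integral_map .of_discrete (by fun_prop), integral_poissonMeasure]
    simpa using (hasSum_poisson_mul_natCast_sq r).tsum_eq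
  rw [h]
  simp [integral_id_map_cast_poissonMeasure]

end PoissonMoments

/-! ### Variance bounds, random series and Kronecker's lemma -/

theorem integral_abs_sub_mean_le_sqrt_variance {Ω : Type*} [MeasurableSpace Ω] {P : Measure Ω}
    [IsProbabilityMeasure P] {X : Ω → ℝ} (hX : MemLp X 2 P) :
    ∫ ω, |X ω - ∫ ω', X ω' ∂P| ∂P ≤ √(Var[X; P]) := by
  have hY : MemLp (fun ω => |X ω - ∫ ω', X ω' ∂P|) 2 P := (hX.sub (memLp_const _)).abs
  -- $\operatorname{Var}|X-EX|\ge0$ is exactly $(E|X-EX|)^2\le\operatorname{Var}X$.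
  have h := variance_nonneg (fun ω => |X ω - ∫ ω', X ω' ∂P|) P
  rw [variance_eq_sub hY] at h
  refine Real.le_sqrt_of_sq_le ?_
  rw [variance_eq_integral hX.1.aemeasurable]
  simpa using h

theorem eLpNorm_one_sub_mean_le {Ω : Type*} [MeasurableSpace Ω] {P : Measure Ω}
    [IsProbabilityMeasure P] {X : Ω → ℝ} (hX : MemLp X 2 P) :
    eLpNorm (fun ω => X ω - ∫ ω', X ω' ∂P) 1 P ≤ ENNReal.ofReal (√(Var[X; P])) := by
  have hi : Integrable (fun ω => X ω - ∫ ω', X ω' ∂P) P :=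
    (hX.integrable (by norm_num)).sub (integrable_const _)
  rw [eLpNorm_one_eq_lintegral_enorm, ← ofReal_integral_norm_eq_lintegral_enorm hi]
  exact ENNReal.ofReal_le_ofReal (integral_abs_sub_mean_le_sqrt_variance hX)

/-- A series of independent centred square-integrable random variables whose variances are
summable converges almost surely. -/
theorem ae_exists_tendsto_sum_of_summable_variance {Ω : Type*} [MeasurableSpace Ω] {P : Measure Ω}
    [IsProbabilityMeasure P] {X : ℕ → Ω → ℝ} (hmeas : ∀ n, Measurable (X n))
    (hindep : iIndepFun X P) (hL2 : ∀ n, MemLp (X n) 2 P) (hmean : ∀ n, ∫ ω, X n ω ∂P = 0)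
    (hsum : Summable fun n => Var[X n; P]) :
    ∀ᵐ ω ∂P, ∃ c, Tendsto (fun n => ∑ i ∈ Finset.range n, X i ω) atTop (𝓝 c) := by
  have hsm : ∀ n, StronglyMeasurable (X n) := fun n => (hmeas n).stronglyMeasurable
  set G := Filtration.natural X hsm
  have hadX : ∀ n, StronglyMeasurable[G n] (X n) := Filtration.stronglyAdapted_natural hsm
  set S : ℕ → Ω → ℝ := fun n => ∑ i ∈ Finset.range (n + 1), X i
  have hSsucc : ∀ n, S (n + 1) = S n + X (n + 1) := fun n => Finset.sum_range_succ _ _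
  have hadS : ∀ n, StronglyMeasurable[G n] (S n) := fun n =>
    Finset.stronglyMeasurable_sum _ fun i hi =>
      (hadX i).mono (G.mono (by simpa [Nat.lt_succ_iff] using hi))
  have hSL2 : ∀ n, MemLp (S n) 2 P := fun n => memLp_finsetSum' _ fun i _ => hL2 i
  have hSint : ∀ n, Integrable (S n) P := fun n => (hSL2 n).integrable (by norm_num)
  have hmart : Martingale S G P := by
    refine martingale_nat hadS hSint fun n => ?_
    have h1 : P[S (n + 1) | G n] =ᵐ[P] P[S n | G n] + P[X (n + 1) | G n] := by
      rw [hSsucc]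
      exact condExp_add (hSint n) ((hL2 _).integrable (by norm_num)) _
    have h2 := hindep.condExp_natural_ae_eq_of_lt hsm (Nat.lt_succ_self n)
    rw [condExp_of_stronglyMeasurable (G.le n) (hadS n) (hSint n)] at h1
    filter_upwards [h1, h2] with ω h1 h2
    rw [h1, Pi.add_apply]
    erw [h2]
    simp [hmean]
  have hSmean : ∀ n, ∫ ω, S n ω ∂P = 0 := fun n => by
    simp only [S, Finset.sum_apply]
    rw [integral_finsetSum _ fun i _ => (hL2 i).integrable (by norm_num)]
    simp [hmean]
  -- The variances of independent summands add, so the martingale is bounded in $L^1$ by the root of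
  -- the total variance.
  have hbdd : ∀ n, eLpNorm (S n) 1 P ≤ ((√(∑' i, Var[X i; P])).toNNReal : ℝ≥0∞) := fun n => by
    have h := eLpNorm_one_sub_mean_le (hSL2 n)
    simp only [hSmean, sub_zero] at h
    refine h.trans (ENNReal.ofReal_le_ofReal (Real.sqrt_le_sqrt ?_))
    rw [IndepFun.variance_sum (fun i _ => hL2 i) fun i _ j _ hij => hindep.indepFun hij]
    exact hsum.sum_le_tsum _ fun i _ => variance_nonneg _ _
  filter_upwards [hmart.submartingale.exists_ae_tendsto_of_bdd hbdd] with ω ⟨c, hc⟩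
  refine ⟨c, (tendsto_add_atTop_iff_nat 1).1 ?_⟩
  simpa [S] using hc

/-- **Kronecker's lemma.** -/
theorem tendsto_sum_div_zero_of_tendsto_sum_div {b x : ℕ → ℝ} {c : ℝ} (hb : Monotone b)
    (hpos : ∀ n, 0 < b n) (htop : Tendsto b atTop atTop)
    (h : Tendsto (fun n => ∑ i ∈ Finset.range n, x i / b i) atTop (𝓝 c)) :
    Tendsto (fun n => (∑ i ∈ Finset.range n, x i) / b n) atTop (𝓝 0) := by
  set D : ℕ → ℝ := fun n => ∑ i ∈ Finset.range n, x i / b i - c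
  have hD : Tendsto D atTop (𝓝 0) := by simpa [D] using h.sub_const c
  -- Summation by parts against the centred partial sums $D_n\to0$; the last sum, divided by $b_n$,
  -- is essentially a weighted average of the $D_{i+1}$.
  have habel : ∀ n, ∑ i ∈ Finset.range n, x i =
      b n * D n - b 0 * D 0 - ∑ i ∈ Finset.range n, (b (i + 1) - b i) * D (i + 1) := by
    intro n
    induction n with
    | zero => simp
    | succ n ih =>
      have hx : x n = b n * (D (n + 1) - D n) := by
        simp only [D, Finset.sum_range_succ]
        have := (hpos n).ne'
        field_simp
        ring
      rw [Finset.sum_range_succ, Finset.sum_range_succ, ih, hx]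
      ring
  have hsumg : ∀ n, ∑ i ∈ Finset.range n, (b (i + 1) - b i) = b n - b 0 :=
    fun n => Finset.sum_range_sub b n
  have hlit : (fun n => ∑ i ∈ Finset.range n, (b (i + 1) - b i) * D (i + 1)) =o[atTop]
      fun n => ∑ i ∈ Finset.range n, (b (i + 1) - b i) := by
    refine Asymptotics.IsLittleO.sum_range ?_ (fun i => sub_nonneg.2 (hb i.le_succ)) ?_
    · have h1 : (fun n => D (n + 1)) =o[atTop] fun _ => (1 : ℝ) :=
        (Asymptotics.isLittleO_one_iff ℝ).2 ((tendsto_add_atTop_iff_nat 1).2 hD)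
      simpa using (Asymptotics.isBigO_refl (fun n => b (n + 1) - b n) atTop).mul_isLittleO h1
    · simp only [hsumg]
      exact tendsto_atTop_add_const_right _ _ htop
  have hbig : (fun n => ∑ i ∈ Finset.range n, (b (i + 1) - b i)) =O[atTop] b := by
    refine Asymptotics.IsBigO.of_bound 1 (Eventually.of_forall fun n => ?_)
    have := hb (Nat.zero_le n)
    rw [hsumg, Real.norm_of_nonneg (by linarith), Real.norm_of_nonneg (hpos n).le]
    linarith [hpos 0]
  have h3 := (hlit.trans_isBigO hbig).tendsto_div_nhds_zero
  have h2 : Tendsto (fun n => b 0 * D 0 / b n) atTop (𝓝 0) := htop.const_div_atTop _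
  have := (hD.sub h2).sub h3
  simp only [sub_zero] at this
  refine this.congr fun n => ?_
  rw [habel]
  have := (hpos n).ne'
  field_simp

/-- The extra term $x_n/b_n$ is a difference of consecutive convergent partial sums. This version
bounds a process at the right end of a cell by the weight at its left end. -/
theorem tendsto_sum_succ_div_zero_of_tendsto_sum_div {b x : ℕ → ℝ} {c : ℝ} (hb : Monotone b)
    (hpos : ∀ n, 0 < b n) (htop : Tendsto b atTop atTop)
    (h : Tendsto (fun n => ∑ i ∈ Finset.range n, x i / b i) atTop (𝓝 c)) :
    Tendsto (fun n => (∑ i ∈ Finset.range (n + 1), x i) / b n) atTop (𝓝 0) := by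
  have h1 : Tendsto (fun n => x n / b n) atTop (𝓝 0) := by
    simpa [Finset.sum_range_succ] using (((tendsto_add_atTop_iff_nat 1).2 h).sub h)
  simpa [Finset.sum_range_succ, add_div] using
    (tendsto_sum_div_zero_of_tendsto_sum_div hb hpos htop h).add h1

/-! ### Cumulative rates and moments of Poisson processes -/

namespace IsRateFunction

variable {lam : ℝ → ℝ}

theorem intervalIntegrable (h : IsRateFunction lam) {s t : ℝ} (hs : 0 ≤ s) (ht : 0 ≤ t) :
    IntervalIntegrable lam volume s t :=
  (h.integrable s hs).symm.trans (h.integrable t ht)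

theorem cumulativeRate_nonneg (h : IsRateFunction lam) {s t : ℝ} (hs : 0 ≤ s) (hst : s ≤ t) :
    0 ≤ cumulativeRate lam s t :=
  intervalIntegral.integral_nonneg hst fun x hx => h.nonneg x (hs.trans hx.1)

theorem cumulativeRate_add (h : IsRateFunction lam) {s t u : ℝ} (hs : 0 ≤ s) (ht : 0 ≤ t)
    (hu : 0 ≤ u) : cumulativeRate lam s t + cumulativeRate lam t u = cumulativeRate lam s u :=
  intervalIntegral.integral_add_adjacent_intervals (h.intervalIntegrable hs ht)
    (h.intervalIntegrable ht hu)

theorem cumulativeRate_mono_right (h : IsRateFunction lam) {s t u : ℝ} (hs : 0 ≤ s) (hst : s ≤ t)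
    (htu : t ≤ u) : cumulativeRate lam s t ≤ cumulativeRate lam s u := by
  have := h.cumulativeRate_nonneg (hs.trans hst) htu
  rw [← h.cumulativeRate_add hs (hs.trans hst) (hs.trans (hst.trans htu))]
  linarith

theorem continuousOn_cumulativeRate (h : IsRateFunction lam) {s t : ℝ} (hs : 0 ≤ s)
    (hst : s ≤ t) : ContinuousOn (fun x => cumulativeRate lam s x) (Set.Icc s t) := by
  have := intervalIntegral.continuousOn_primitive_interval'
    (h.intervalIntegrable hs (hs.trans hst)) (Set.left_mem_uIcc)
  rwa [Set.uIcc_of_le hst] at this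

end IsRateFunction

theorem cumulativeRate_self (lam : ℝ → ℝ) (s : ℝ) : cumulativeRate lam s s = 0 :=
  intervalIntegral.integral_same

namespace IsPoissonProcess

variable {Ω : Type*} [MeasurableSpace Ω] {P : Measure Ω} {lam : ℝ → ℝ} {N : ℝ≥0 → Ω → ℕ}

theorem measurable_natCast (hN : IsPoissonProcess P lam N) (t : ℝ≥0) :
    Measurable fun ω => (N t ω : ℝ) :=
  (measurable_of_countable fun n : ℕ => (n : ℝ)).comp (hN.measurable t)

theorem memLp_increment (hN : IsPoissonProcess P lam N) {s t : ℝ≥0} (hst : s ≤ t) :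
    MemLp (fun ω => (N t ω : ℝ) - (N s ω : ℝ)) 2 P := by
  have h := memLp_two_id_map_cast_poissonMeasure (cumulativeRate lam s t).toNNReal
  rw [← (hN.increments s t hst).map_eq] at h
  exact (memLp_map_measure_iff (by fun_prop) (hN.increments s t hst).aemeasurable).1 h

theorem integral_increment (hN : IsPoissonProcess P lam N) {s t : ℝ≥0} (hst : s ≤ t) :
    ∫ ω, ((N t ω : ℝ) - (N s ω : ℝ)) ∂P = cumulativeRate lam s t := by
  rw [(hN.increments s t hst).integral_eq, integral_id_map_cast_poissonMeasure,
    Real.coe_toNNReal _ (hN.isRateFunction.cumulativeRate_nonneg s.coe_nonneg (NNReal.coe_le_coe.2 hst))]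

theorem variance_increment (hN : IsPoissonProcess P lam N) {s t : ℝ≥0} (hst : s ≤ t) :
    Var[fun ω => (N t ω : ℝ) - (N s ω : ℝ); P] = cumulativeRate lam s t := by
  rw [(hN.increments s t hst).variance_eq, variance_id_map_cast_poissonMeasure,
    Real.coe_toNNReal _ (hN.isRateFunction.cumulativeRate_nonneg s.coe_nonneg (NNReal.coe_le_coe.2 hst))]

theorem increment_zero_ae_eq (hN : IsPoissonProcess P lam N) (t : ℝ≥0) :
    (fun ω => (N t ω : ℝ) - (N 0 ω : ℝ)) =ᵐ[P] fun ω => (N t ω : ℝ) := by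
  filter_upwards [hN.zero] with ω hω
  simp [hω]

theorem hasLaw (hN : IsPoissonProcess P lam N) (t : ℝ≥0) :
    HasLaw (fun ω => (N t ω : ℝ))
      ((poissonMeasure (cumulativeRate lam 0 t).toNNReal).map (fun n : ℕ => (n : ℝ))) P :=
  (hN.increments 0 t zero_le).congr (hN.increment_zero_ae_eq t).symm

theorem memLp (hN : IsPoissonProcess P lam N) (t : ℝ≥0) : MemLp (fun ω => (N t ω : ℝ)) 2 P :=
  (memLp_congr_ae (hN.increment_zero_ae_eq t)).1 (hN.memLp_increment zero_le)

theorem integral_eq (hN : IsPoissonProcess P lam N) (t : ℝ≥0) :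
    ∫ ω, (N t ω : ℝ) ∂P = cumulativeRate lam 0 t := by
  rw [← integral_congr_ae (hN.increment_zero_ae_eq t)]
  exact hN.integral_increment zero_le

theorem variance_eq (hN : IsPoissonProcess P lam N) (t : ℝ≥0) :
    Var[fun ω => (N t ω : ℝ); P] = cumulativeRate lam 0 t := by
  rw [← variance_congr (hN.increment_zero_ae_eq t)]
  exact hN.variance_increment zero_le

theorem tendsto_eLpNorm_div_sub [IsProbabilityMeasure P] (hN : IsPoissonProcess P lam N)
    {g : ℝ≥0 → ℝ} (hg : Tendsto g atTop atTop) {μ : ℝ}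
    (h : Tendsto (fun t : ℝ≥0 => cumulativeRate lam 0 t / g t) atTop (𝓝 μ)) :
    Tendsto (fun t : ℝ≥0 => eLpNorm (fun ω => (N t ω : ℝ) / g t - μ) 1 P) atTop (𝓝 0) := by
  have hbound : ∀ t : ℝ≥0, eLpNorm (fun ω => (N t ω : ℝ) / g t - μ) 1 P ≤
      ENNReal.ofReal (√(cumulativeRate lam 0 t / g t / g t)) +
        ENNReal.ofReal |cumulativeRate lam 0 t / g t - μ| := by
    intro t
    have hL2 : MemLp (fun ω => (g t)⁻¹ * (N t ω : ℝ)) 2 P := (hN.memLp t).const_mul _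
    have h1 := eLpNorm_one_sub_mean_le hL2
    rw [integral_const_mul, hN.integral_eq, variance_const_mul, hN.variance_eq] at h1
    -- Split into the random fluctuation and the deterministic bias.
    have h2 : (fun ω => (N t ω : ℝ) / g t - μ) =
        (fun ω => (g t)⁻¹ * (N t ω : ℝ) - (g t)⁻¹ * cumulativeRate lam 0 t) +
          fun _ => cumulativeRate lam 0 t / g t - μ := by
      ext ω
      simp only [Pi.add_apply]
      ring
    rw [h2]
    refine (eLpNorm_add_le (hL2.1.sub aestronglyMeasurable_const) aestronglyMeasurable_const
      le_rfl).trans (add_le_add (h1.trans_eq ?_) (le_of_eq ?_))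
    · congr 2
      ring
    · rw [eLpNorm_const _ one_ne_zero (IsProbabilityMeasure.ne_zero P)]
      simp [Real.enorm_eq_ofReal_abs]
  have h1 : Tendsto (fun t : ℝ≥0 => √(cumulativeRate lam 0 t / g t / g t)) atTop (𝓝 0) := by
    simpa using (h.div_atTop hg).sqrt
  have h2 : Tendsto (fun t : ℝ≥0 => |cumulativeRate lam 0 t / g t - μ|) atTop (𝓝 0) := by
    simpa using (h.sub_const μ).abs
  refine tendsto_of_tendsto_of_tendsto_of_le_of_le tendsto_const_nhds ?_ (fun _ => zero_le) hbound
  simpa using (ENNReal.tendsto_ofReal h1).add (ENNReal.tendsto_ofReal h2)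

end IsPoissonProcess

/-! ### Partitions adapted to the rate -/

/-- Take the next integer, or the earlier time at which the rate accumulated since $s$ equals 1.
Either way $\lfloor\cdot\rfloor+\Lambda$ gains at least 1, which forces the iterates to infinity. -/
theorem IsRateFunction.exists_next_time {lam : ℝ → ℝ} (h : IsRateFunction lam) (s : ℝ≥0) :
    ∃ u : ℝ≥0, s ≤ u ∧ u ≤ ⌊s⌋₊ + 1 ∧ cumulativeRate lam s u ≤ 1 ∧
      (⌊s⌋₊ : ℝ) + cumulativeRate lam 0 s + 1 ≤ ⌊u⌋₊ + cumulativeRate lam 0 u := by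
  have hlt : s < ⌊s⌋₊ + 1 := Nat.lt_floor_add_one s
  have hlt' : (s : ℝ) ≤ ⌊s⌋₊ + 1 := by exact_mod_cast hlt.le
  by_cases hle : cumulativeRate lam s (⌊s⌋₊ + 1) ≤ 1
  · refine ⟨⌊s⌋₊ + 1, hlt.le, le_rfl, by simpa using hle, ?_⟩
    have h1 : ⌊(⌊s⌋₊ + 1 : ℝ≥0)⌋₊ = ⌊s⌋₊ + 1 := by
      exact_mod_cast Nat.floor_natCast (R := ℝ≥0) (⌊s⌋₊ + 1)
    have h2 := h.cumulativeRate_mono_right le_rfl s.coe_nonneg hlt'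
    rw [h1]
    push_cast
    linarith
  · obtain ⟨x, hx, hx1⟩ := intermediate_value_Icc hlt' (h.continuousOn_cumulativeRate s.coe_nonneg hlt')
      ⟨by simp [cumulativeRate_self], (not_le.1 hle).le⟩
    have hx0 : 0 ≤ x := s.coe_nonneg.trans hx.1
    lift x to ℝ≥0 using hx0
    have hsx : s ≤ x := by exact_mod_cast hx.1
    refine ⟨x, hsx, by exact_mod_cast hx.2, hx1.le, ?_⟩
    have h1 : (⌊s⌋₊ : ℝ) ≤ ⌊x⌋₊ := by exact_mod_cast Nat.floor_mono hsx
    have h2 := h.cumulativeRate_add le_rfl s.coe_nonneg x.coe_nonneg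
    simp only at hx1
    linarith

theorem IsRateFunction.exists_partition {lam : ℝ → ℝ} (h : IsRateFunction lam) :
    ∃ t : ℕ → ℝ≥0, t 0 = 0 ∧ Monotone t ∧ Tendsto t atTop atTop ∧
      ∀ j, t (j + 1) ≤ ⌊t j⌋₊ + 1 ∧ cumulativeRate lam (t j) (t (j + 1)) ≤ 1 := by
  choose u hle hfloor hone hinc using h.exists_next_time
  set t : ℕ → ℝ≥0 := fun j => u^[j] 0
  have hsucc : ∀ j, t (j + 1) = u (t j) := fun j => Function.iterate_succ_apply' u j 0
  have hmono : Monotone t := monotone_nat_of_le_succ fun j => by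
    rw [hsucc]
    exact hle _
  have hgrow : ∀ j : ℕ, (j : ℝ) ≤ ⌊t j⌋₊ + cumulativeRate lam 0 (t j) := by
    intro j
    induction j with
    | zero => simp [t, cumulativeRate_self]
    | succ j ih =>
      have := hinc (t j)
      rw [hsucc]
      push_cast
      linarith
  refine ⟨t, rfl, hmono, tendsto_atTop_atTop_of_monotone hmono fun B => ?_, fun j => ?_⟩
  · by_contra! hB
    obtain ⟨n, hn⟩ := exists_nat_gt ((B : ℝ) + cumulativeRate lam 0 B)
    have h1 : (⌊t n⌋₊ : ℝ) ≤ t n := by exact_mod_cast Nat.floor_le (zero_le : 0 ≤ t n)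
    have h2 : (t n : ℝ) ≤ B := by exact_mod_cast (hB n).le
    have h3 := h.cumulativeRate_mono_right le_rfl (t n).coe_nonneg h2
    have h4 := hgrow n
    linarith
  · rw [hsucc]
    exact ⟨hfloor _, hone _⟩

/-- No cell crosses an integer, so all cells inside $[k,k+1]$ carry the weight $w_k$ and their rates
add up to at most $\Lambda(k,k+1)$. -/
theorem IsRateFunction.sum_partition_div_sq_le {lam : ℝ → ℝ} (h : IsRateFunction lam)
    {w : ℕ → ℝ} (hsum : Summable fun k : ℕ => cumulativeRate lam k (k + 1) / w k ^ 2)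
    {t : ℕ → ℝ≥0} (ht0 : t 0 = 0) (ht : Monotone t) (hfloor : ∀ j, t (j + 1) ≤ ⌊t j⌋₊ + 1)
    (n : ℕ) :
    ∑ j ∈ Finset.range n, cumulativeRate lam (t j) (t (j + 1)) / w ⌊t j⌋₊ ^ 2 ≤
      ∑' k : ℕ, cumulativeRate lam k (k + 1) / w k ^ 2 := by
  have hnn : ∀ k : ℕ, 0 ≤ cumulativeRate lam k (k + 1) / w k ^ 2 := fun k =>
    div_nonneg (h.cumulativeRate_nonneg k.cast_nonneg (by linarith)) (sq_nonneg _)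
  have hfl : ∀ s : ℝ≥0, (⌊s⌋₊ : ℝ) ≤ s := fun s => by
    exact_mod_cast Nat.floor_le (zero_le : 0 ≤ s)
  have hfl' : ∀ s : ℝ≥0, (s : ℝ) ≤ ⌊s⌋₊ + 1 := fun s => by
    exact_mod_cast (Nat.lt_floor_add_one s).le
  have hkey : ∑ j ∈ Finset.range n, cumulativeRate lam (t j) (t (j + 1)) / w ⌊t j⌋₊ ^ 2 =
      ∑ k ∈ Finset.range ⌊t n⌋₊, cumulativeRate lam k (k + 1) / w k ^ 2 +
        cumulativeRate lam ⌊t n⌋₊ (t n) / w ⌊t n⌋₊ ^ 2 := by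
    induction n with
    | zero => simp [ht0, cumulativeRate_self]
    | succ n ih =>
      rw [Finset.sum_range_succ, ih, add_assoc, ← add_div,
        h.cumulativeRate_add (Nat.cast_nonneg _) (t n).coe_nonneg (t (n + 1)).coe_nonneg]
      rcases (hfloor n).lt_or_eq with hlt | heq
      · have : ⌊t (n + 1)⌋₊ = ⌊t n⌋₊ :=
          le_antisymm (Nat.lt_succ_iff.1 ((Nat.floor_lt zero_le).2 (by exact_mod_cast hlt)))
            (Nat.floor_mono (ht n.le_succ))
        rw [this]
      · have h1 : ⌊t (n + 1)⌋₊ = ⌊t n⌋₊ + 1 := by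
          rw [heq]
          exact_mod_cast Nat.floor_natCast (R := ℝ≥0) (⌊t n⌋₊ + 1)
        rw [h1, Finset.sum_range_succ, heq]
        simp [cumulativeRate_self]
  rw [hkey]
  refine le_trans ?_ (hsum.sum_le_tsum (Finset.range (⌊t n⌋₊ + 1)) fun k _ => hnn k)
  rw [Finset.sum_range_succ]
  gcongr
  exact h.cumulativeRate_mono_right (Nat.cast_nonneg _) (hfl _) (hfl' _)

/-! ### Almost sure convergence for one Poisson process -/

namespace IsPoissonProcess

variable {Ω : Type*} [MeasurableSpace Ω] {P : Measure Ω} {lam : ℝ → ℝ} {N : ℝ≥0 → Ω → ℕ}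

theorem ae_tendsto_partition [IsProbabilityMeasure P] (hN : IsPoissonProcess P lam N)
    {w : ℕ → ℝ} (hw : Monotone w) (hwpos : ∀ k, 0 < w k) (hwtop : Tendsto w atTop atTop)
    (hsum : Summable fun k : ℕ => cumulativeRate lam k (k + 1) / w k ^ 2)
    {t : ℕ → ℝ≥0} (ht0 : t 0 = 0) (ht : Monotone t) (httop : Tendsto t atTop atTop)
    (hfloor : ∀ j, t (j + 1) ≤ ⌊t j⌋₊ + 1) :
    ∀ᵐ ω ∂P,
      Tendsto (fun n => ((N (t n) ω : ℝ) - cumulativeRate lam 0 (t n)) / w ⌊t n⌋₊) atTop (𝓝 0) ∧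
      Tendsto (fun n => ((N (t (n + 1)) ω : ℝ) - cumulativeRate lam 0 (t (n + 1))) / w ⌊t n⌋₊)
        atTop (𝓝 0) := by
  have hr := hN.isRateFunction
  set b : ℕ → ℝ := fun n => w ⌊t n⌋₊
  have hb : Monotone b := hw.comp (Nat.floor_mono.comp ht)
  have hbtop : Tendsto b atTop atTop := hwtop.comp (tendsto_nat_floor_atTop.comp httop)
  set x : ℕ → Ω → ℝ := fun j ω =>
    ((N (t (j + 1)) ω : ℝ) - (N (t j) ω : ℝ)) - cumulativeRate lam (t j) (t (j + 1))
  have hle : ∀ j, t j ≤ t (j + 1) := fun j => ht j.le_succ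
  have hxmeas : ∀ j, Measurable (x j) := fun j =>
    ((hN.measurable_natCast _).sub (hN.measurable_natCast _)).sub_const _
  have hxL2 : ∀ j, MemLp (x j) 2 P := fun j => (hN.memLp_increment (hle j)).sub (memLp_const _)
  have hxvar : ∀ j, Var[x j; P] = cumulativeRate lam (t j) (t (j + 1)) := fun j => by
    rw [variance_sub_const (hN.memLp_increment (hle j)).1, hN.variance_increment (hle j)]
  have hxmean : ∀ j, ∫ ω, x j ω ∂P = 0 := fun j => by
    simp only [x]
    rw [integral_sub ((hN.memLp_increment (hle j)).integrable (by norm_num))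
      (integrable_const _), hN.integral_increment (hle j)]
    simp
  have hind : iIndepFun (fun j ω => (b j)⁻¹ * x j ω) P :=
    (hN.indepIncrements.nat ht).comp
      (fun j y => (b j)⁻¹ * (y - cumulativeRate lam (t j) (t (j + 1)))) (fun j => by fun_prop)
  have hconv := ae_exists_tendsto_sum_of_summable_variance (fun j => (hxmeas j).const_mul _) hind
    (fun j => (hxL2 j).const_mul _) (fun j => by rw [integral_const_mul, hxmean, mul_zero])
    (summable_of_sum_range_le (fun j => variance_nonneg _ _) fun n => by
      refine le_trans (le_of_eq ?_) (hr.sum_partition_div_sq_le hsum ht0 ht hfloor n)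
      refine Finset.sum_congr rfl fun j _ => ?_
      rw [variance_const_mul, hxvar]
      ring)
  filter_upwards [hconv, hN.zero] with ω ⟨c, hc⟩ hω
  have htel : ∀ n, ∑ j ∈ Finset.range n, x j ω =
      (N (t n) ω : ℝ) - cumulativeRate lam 0 (t n) := by
    intro n
    induction n with
    | zero => simp [ht0, hω, cumulativeRate_self]
    | succ n ih =>
      rw [Finset.sum_range_succ, ih, ← hr.cumulativeRate_add le_rfl (t n).coe_nonneg (t (n + 1)).coe_nonneg]
      simp only [x]
      ring
  have hc' : Tendsto (fun n => ∑ j ∈ Finset.range n, x j ω / b j) atTop (𝓝 c) := by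
    simpa only [div_eq_inv_mul] using hc
  have h1 := tendsto_sum_div_zero_of_tendsto_sum_div hb (fun n => hwpos _) hbtop hc'
  have h2 := tendsto_sum_succ_div_zero_of_tendsto_sum_div hb (fun n => hwpos _) hbtop hc'
  simp only [htel] at h1 h2
  exact ⟨h1, h2⟩

theorem ae_tendsto_div [IsProbabilityMeasure P] (hN : IsPoissonProcess P lam N) {f : ℝ → ℝ}
    (hfmono : MonotoneOn f (Set.Ici 0)) (hftop : Tendsto f atTop atTop) {μ : ℝ}
    (hμ : Tendsto (fun t : ℝ≥0 => cumulativeRate lam 0 t / f t) atTop (𝓝 μ))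
    (hsum : Summable (fun k : ℕ =>
      cumulativeRate lam ((k : ℝ) + 1) ((k : ℝ) + 2) / f ((k : ℝ) + 1) ^ 2)) :
    ∀ᵐ ω ∂P, Tendsto (fun t : ℝ≥0 => (N t ω : ℝ) / f t) atTop (𝓝 μ) := by
  have hr := hN.isRateFunction
  -- The truncation makes the weights positive and changes only finitely many of them, so
  -- summability is kept whatever the value of terms with $f(k)=0$.
  set w : ℕ → ℝ := fun k => max (f k) 1
  have hwpos : ∀ k, 0 < w k := fun k => lt_max_of_lt_right one_pos
  have hw : Monotone w := fun k l hkl => max_le_max_right _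
    (hfmono (Set.mem_Ici.2 k.cast_nonneg) (Set.mem_Ici.2 l.cast_nonneg) (by exact_mod_cast hkl))
  have hftopN : Tendsto (fun k : ℕ => f k) atTop atTop := hftop.comp tendsto_natCast_atTop_atTop
  have hwtop : Tendsto w atTop atTop := tendsto_atTop_mono (fun k => le_max_left _ _) hftopN
  have hwsum : Summable fun k : ℕ => cumulativeRate lam k (k + 1) / w k ^ 2 := by
    rw [← summable_nat_add_iff 1]
    refine hsum.congr_atTop ?_
    filter_upwards [(tendsto_add_atTop_iff_nat 1).2 hftopN |>.eventually_ge_atTop 1] with k hk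
    simp only [w, max_eq_left hk]
    push_cast
    norm_num [add_assoc]
  obtain ⟨t, ht0, ht, httop, hstep⟩ := hr.exists_partition
  filter_upwards [hN.ae_tendsto_partition hw hwpos hwtop hwsum ht0 ht httop fun j => (hstep j).1,
    hN.paths] with ω ⟨h1, h2⟩ hpath
  set M : ℝ≥0 → ℝ := fun s => (N s ω : ℝ) - cumulativeRate lam 0 s
  -- Both $N$ and $\Lambda$ are monotone and $\Lambda$ varies by at most 1 on the cell.
  have hM : ∀ j s, t j ≤ s → s ≤ t (j + 1) → |M s| ≤ |M (t j)| + |M (t (j + 1))| + 1 := by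
    intro j s hjs hsj
    have h3 : (N (t j) ω : ℝ) ≤ N s ω := by exact_mod_cast hpath.1 hjs
    have h4 : (N s ω : ℝ) ≤ N (t (j + 1)) ω := by exact_mod_cast hpath.1 hsj
    have h5 := hr.cumulativeRate_mono_right le_rfl (t j).coe_nonneg (by exact_mod_cast hjs : (t j : ℝ) ≤ s)
    have h6 := hr.cumulativeRate_mono_right le_rfl s.coe_nonneg
      (by exact_mod_cast hsj : (s : ℝ) ≤ t (j + 1))
    have h7 := (hstep j).2
    have h8 := hr.cumulativeRate_add le_rfl (t j).coe_nonneg (t (j + 1)).coe_nonneg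
    have h9 := neg_abs_le (M (t j))
    have h10 := le_abs_self (M (t (j + 1)))
    have h11 := abs_nonneg (M (t j))
    have h12 := abs_nonneg (M (t (j + 1)))
    simp only [M] at *
    rw [abs_le]
    constructor <;> linarith
  set e : ℕ → ℝ := fun j => |M (t j) / w ⌊t j⌋₊| + |M (t (j + 1)) / w ⌊t j⌋₊| + 1 / w ⌊t j⌋₊
  have he : Tendsto e atTop (𝓝 0) := by
    have h3 := (hwtop.comp (tendsto_nat_floor_atTop.comp httop)).const_div_atTop 1
    simpa only [abs_zero, add_zero, Function.comp_def] using (h1.abs.add h2.abs).add h3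
  have hM0 : Tendsto (fun s : ℝ≥0 => M s / f s) atTop (𝓝 0) := by
    rw [Metric.tendsto_atTop]
    intro ε hε
    obtain ⟨J, hJ⟩ := eventually_atTop.1 (he.eventually_lt_const hε)
    have hftop' : Tendsto (fun s : ℝ≥0 => f s) atTop atTop :=
      hftop.comp (NNReal.tendsto_coe_atTop.2 tendsto_id)
    obtain ⟨B, hB⟩ := eventually_atTop.1 (hftop'.eventually_ge_atTop 1)
    refine ⟨max (t J) B, fun s hs => ?_⟩
    -- The cell containing $s$ ends at the first cut point beyond $s$; its index is not 0 because
    -- $t_0=0$.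
    have hex : ∃ n, s < t n := (httop.eventually_gt_atTop s).exists
    obtain ⟨j, hj⟩ : ∃ j, Nat.find hex = j + 1 := Nat.exists_eq_succ_of_ne_zero fun h0 => by
      have := Nat.find_spec hex
      rw [h0, ht0] at this
      exact not_lt_zero this
    have hsj : s < t (j + 1) := hj ▸ Nat.find_spec hex
    have hjs : t j ≤ s := not_lt.1 (Nat.find_min hex (by omega))
    have hJj : J ≤ j := by
      by_contra! hlt
      exact (hsj.trans_le (ht hlt)).not_ge ((le_max_left _ _).trans hs)
    have hfs : 1 ≤ f s := hB s ((le_max_right _ _).trans hs)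
    have hwf : w ⌊t j⌋₊ ≤ f s := by
      refine max_le (hfmono (Set.mem_Ici.2 (Nat.cast_nonneg _)) (Set.mem_Ici.2 s.coe_nonneg) ?_) hfs
      exact_mod_cast (Nat.floor_le zero_le).trans hjs
    rw [Real.dist_eq, sub_zero, abs_div, abs_of_pos (one_pos.trans_le hfs)]
    calc |M s| / f s ≤ (|M (t j)| + |M (t (j + 1))| + 1) / w ⌊t j⌋₊ := by
          gcongr
          exact hM j s hjs hsj.le
      _ = e j := by
          simp only [e, abs_div, abs_of_pos (hwpos _), add_div]
      _ < ε := hJ j hJj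
  have := hM0.add hμ
  rw [zero_add] at this
  refine this.congr fun s => ?_
  simp only [M]
  ring

end IsPoissonProcess

/-! ### Characteristic functions and the normal limit -/

theorem norm_cexp_mul_I_sub_taylor_two_le (y : ℝ) :
    ‖Complex.exp (y * Complex.I) - 1 - y * Complex.I + (y : ℂ) ^ 2 / 2‖ ≤
      |y| ^ 3 * Real.exp |y| := by
  have h := Complex.norm_exp_sub_sum_le_norm_mul_exp (y * Complex.I) 3
  simp only [norm_mul, Complex.norm_I, mul_one, Complex.norm_real, Real.norm_eq_abs] at h
  refine le_trans (le_of_eq ?_) h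
  congr 1
  simp [Finset.sum_range_succ, mul_pow]
  ring

/-- The cubic remainder is at most $(L/g^2)\,c^2\,|c/g|\,e^{|c/g|}$, a convergent factor times one
tending to 0. -/
theorem tendsto_mul_cexp_sub_taylor_two {α : Type*} {l : Filter α} {L g : α → ℝ} {v : ℝ}
    (hL : ∀ t, 0 ≤ L t) (hg : Tendsto g l atTop) (hv : Tendsto (fun t => L t / g t ^ 2) l (𝓝 v))
    (c : ℝ) :
    Tendsto (fun t => (L t : ℂ) * (Complex.exp ((c / g t : ℝ) * Complex.I) - 1 -
      (c / g t : ℝ) * Complex.I + ((c / g t : ℝ) : ℂ) ^ 2 / 2)) l (𝓝 0) := by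
  have hc : Tendsto (fun t => |c / g t|) l (𝓝 0) := by
    simpa using (hg.const_div_atTop c).abs
  have hlim : Tendsto (fun t => L t / g t ^ 2 * c ^ 2 * |c / g t| * Real.exp |c / g t|) l
      (𝓝 0) := by
    simpa using ((hv.mul_const (c ^ 2)).mul hc).mul hc.rexp
  refine squeeze_zero_norm (fun t => ?_) hlim
  rw [norm_mul, Complex.norm_real, Real.norm_of_nonneg (hL t)]
  refine (mul_le_mul_of_nonneg_left (norm_cexp_mul_I_sub_taylor_two_le _) (hL t)).trans_eq ?_
  rw [pow_succ, sq_abs, div_pow]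
  ring

theorem tendsto_sum_mul_cexp_sub_one {ι α : Type*} [Fintype ι] {l : Filter α} {L : ι → α → ℝ}
    {g : α → ℝ} {x v : ι → ℝ} {a : ℝ} (hL : ∀ i t, 0 ≤ L i t) (hg : Tendsto g l atTop)
    (ha : Tendsto (fun t => ∑ i, x i * L i t / g t) l (𝓝 a))
    (hv : ∀ i, Tendsto (fun t => L i t / g t ^ 2) l (𝓝 (v i))) (u : ℝ) :
    Tendsto (fun t => ∑ i, (L i t : ℂ) * (Complex.exp ((x i * u / g t : ℝ) * Complex.I) - 1)) l
      (𝓝 (u * a * Complex.I - (∑ i, x i ^ 2 * v i : ℝ) * u ^ 2 / 2)) := by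
  have h1 : Tendsto (fun t => ∑ i, (L i t : ℂ) * (Complex.exp ((x i * u / g t : ℝ) * Complex.I) -
      1 - (x i * u / g t : ℝ) * Complex.I + ((x i * u / g t : ℝ) : ℂ) ^ 2 / 2)) l (𝓝 0) := by
    simpa using tendsto_finsetSum Finset.univ fun i _ =>
      tendsto_mul_cexp_sub_taylor_two (hL i) hg (hv i) (x i * u)
  have h2 : Tendsto (fun t => (u : ℂ) * (∑ i, x i * L i t / g t : ℝ) * Complex.I) l
      (𝓝 (u * a * Complex.I)) :=
    (((Complex.continuous_ofReal.tendsto a).comp ha).const_mul _).mul_const _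
  have h3 : Tendsto (fun t => ((∑ i, x i ^ 2 * (L i t / g t ^ 2) : ℝ) : ℂ) * u ^ 2 / 2) l
      (𝓝 (((∑ i, x i ^ 2 * v i : ℝ) : ℂ) * u ^ 2 / 2)) :=
    (((Complex.continuous_ofReal.tendsto _).comp
      (tendsto_finsetSum Finset.univ fun i _ => (hv i).const_mul (x i ^ 2))).mul_const _).div_const _
  have h := (h1.add h2).sub h3
  rw [zero_add] at h
  refine h.congr fun t => ?_
  push_cast
  simp only [Finset.mul_sum, Finset.sum_mul, Finset.sum_div, ← Finset.sum_add_distrib,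
    ← Finset.sum_sub_distrib]
  refine Finset.sum_congr rfl fun i _ => ?_
  ring

theorem charFun_sum_const_mul_poissonProcess {Ω ι : Type*} [Fintype ι] [MeasurableSpace Ω]
    {P : Measure Ω} [IsProbabilityMeasure P] {lam : ι → ℝ → ℝ} {N : ι → ℝ≥0 → Ω → ℕ}
    (hN : ∀ i, IsPoissonProcess P (lam i) (N i))
    (hind : iIndepFun (fun (i : ι) (ω : Ω) (t : ℝ≥0) => N i t ω) P) (c : ι → ℝ) (t : ℝ≥0)
    (u : ℝ) :
    charFun (P.map fun ω => ∑ i, c i * (N i t ω : ℝ)) u =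
      Complex.exp (∑ i, (cumulativeRate (lam i) 0 t : ℂ) *
        (Complex.exp ((c i * u : ℝ) * Complex.I) - 1)) := by
  have hind' : iIndepFun (fun i ω => c i * (N i t ω : ℝ)) P :=
    hind.comp (fun i (p : ℝ≥0 → ℕ) => c i * (p t : ℝ)) fun i =>
      ((measurable_of_countable fun n : ℕ => (n : ℝ)).comp (measurable_pi_apply t)).const_mul _
  rw [hind'.charFun_map_fun_sum_eq_prod
    fun i => (((hN i).measurable_natCast t).const_mul _).aemeasurable, Finset.prod_apply,
    Complex.exp_sum]
  refine Finset.prod_congr rfl fun i _ => ?_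
  rw [charFun_map_mul_comp ((hN i).measurable_natCast t).aemeasurable, ((hN i).hasLaw t).map_eq]
  have h0 := (hN i).isRateFunction.cumulativeRate_nonneg le_rfl t.coe_nonneg
  have := charFun_map_cast_poissonMeasure (cumulativeRate (lam i) 0 t).toNNReal (c i * u)
  simpa [h0] using this

theorem tendstoInDistribution_sum_poissonProcess {Ω ι : Type*} [Fintype ι] [MeasurableSpace Ω]
    {P : Measure Ω} [IsProbabilityMeasure P] {lam : ι → ℝ → ℝ} {N : ι → ℝ≥0 → Ω → ℕ}
    (hN : ∀ i, IsPoissonProcess P (lam i) (N i))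
    (hind : iIndepFun (fun (i : ι) (ω : Ω) (t : ℝ≥0) => N i t ω) P) {S : ℝ≥0 → Ω → ℝ} {x : ι → ℝ}
    (hS : ∀ t, S t =ᵐ[P] fun ω => ∑ i, x i * (N i t ω : ℝ)) {g : ℝ≥0 → ℝ}
    (hg : Tendsto g atTop atTop) {a : ℝ} {v : ι → ℝ} (hv0 : ∀ i, 0 ≤ v i)
    (ha : Tendsto (fun t : ℝ≥0 => ∑ i, x i * cumulativeRate (lam i) 0 t / g t) atTop (𝓝 a))
    (hv : ∀ i, Tendsto (fun t : ℝ≥0 => cumulativeRate (lam i) 0 t / g t ^ 2) atTop (𝓝 (v i))) :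
    TendstoInDistribution (fun (t : ℝ≥0) ω => S t ω / g t) atTop (id : ℝ → ℝ) (fun _ => P)
      (gaussianReal a (∑ i, x i ^ 2 * v i).toNNReal) := by
  have hae : ∀ t, (fun ω => S t ω / g t) =ᵐ[P] fun ω => ∑ i, (x i / g t) * (N i t ω : ℝ) := by
    intro t
    filter_upwards [hS t] with ω hω
    rw [hω, Finset.sum_div]
    exact Finset.sum_congr rfl fun i _ => by ring
  have hmeas : ∀ t, AEMeasurable (fun ω => S t ω / g t) P := fun t =>
    (Finset.measurable_fun_sum _ fun i _ =>
      ((hN i).measurable_natCast t).const_mul _).aemeasurable.congr (hae t).symm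
  have hvsum : 0 ≤ ∑ i, x i ^ 2 * v i :=
    Finset.sum_nonneg fun i _ => mul_nonneg (sq_nonneg _) (hv0 i)
  have hchar : ∀ u : ℝ, Tendsto (fun t => charFun (P.map fun ω => S t ω / g t) u) atTop
      (𝓝 (charFun (gaussianReal a (∑ i, x i ^ 2 * v i).toNNReal) u)) := by
    intro u
    have h := (tendsto_sum_mul_cexp_sub_one (fun i (t : ℝ≥0) =>
      (hN i).isRateFunction.cumulativeRate_nonneg le_rfl t.coe_nonneg) hg ha hv u).cexp
    rw [charFun_gaussianReal, Real.coe_toNNReal _ hvsum]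
    refine h.congr fun t => ?_
    rw [Measure.map_congr (hae t), charFun_sum_const_mul_poissonProcess hN hind]
    congr! 7
    ring
  -- Lévy's theorem is applied along arbitrary sequences of times tending to infinity.
  refine ⟨hmeas, aemeasurable_id, tendsto_of_seq_tendsto fun s hs => ?_⟩
  refine ProbabilityMeasure.tendsto_iff_tendsto_charFun.2 fun u => ?_
  change Tendsto _ _ (𝓝 (charFun (Measure.map id (gaussianReal _ _)) u))
  rw [Measure.map_id]
  exact (hchar u).comp hs

/-! ### Combining the jump sizes -/

theorem tendsto_eLpNorm_sum_const_mul {ι α Ω : Type*} [Fintype ι] [MeasurableSpace Ω]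
    {P : Measure Ω} {l : Filter α} {Y : ι → α → Ω → ℝ} (x : ι → ℝ)
    (hY : ∀ i t, AEStronglyMeasurable (Y i t) P)
    (h : ∀ i, Tendsto (fun t => eLpNorm (Y i t) 1 P) l (𝓝 0)) :
    Tendsto (fun t => eLpNorm (fun ω => ∑ i, x i * Y i t ω) 1 P) l (𝓝 0) := by
  have hlim : Tendsto (fun t => ∑ i, ‖x i‖ₑ * eLpNorm (Y i t) 1 P) l (𝓝 0) := by
    simpa using tendsto_finsetSum Finset.univ fun i _ =>
      ENNReal.Tendsto.const_mul (h i) (Or.inr enorm_ne_top)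
  refine tendsto_of_tendsto_of_tendsto_of_le_of_le tendsto_const_nhds hlim
    (fun _ => zero_le) fun t => ?_
  have h1 : (fun ω => ∑ i, x i * Y i t ω) = ∑ i, x i • Y i t := by
    ext ω
    simp
  rw [h1]
  refine (eLpNorm_sum_le (fun i _ => (hY i t).const_smul (x i)) le_rfl).trans_eq ?_
  simp [eLpNorm_const_smul]

theorem mainTheorem6 {Ω : Type*} [MeasurableSpace Ω] (P : Measure Ω) [IsProbabilityMeasure P]
    (I : Finset ℝ) (lam : I → ℝ → ℝ) (S : ℝ≥0 → Ω → ℝ)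
    (hS : IsGeneralizedSkellamProcess P I lam S)
    (f : ℝ → ℝ) (hf : ContDiffOn ℝ 1 f (Set.Ici 0)) (hf0 : ∀ t, 0 ≤ t → 0 ≤ f t)
    (hfmono : MonotoneOn f (Set.Ici 0)) (hftop : Tendsto f atTop atTop) :
    (∀ μ : I → ℝ, (∀ i, 0 ≤ μ i) →
      (∀ i, Tendsto (fun t : ℝ≥0 => cumulativeRate (lam i) 0 t / f t) atTop (𝓝 (μ i))) →
      TendstoInMeasure P (fun (t : ℝ≥0) ω => S t ω / f t) atTop
        (fun _ => ∑ i : I, (i : ℝ) * μ i) ∧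
      (∀ t : ℝ≥0, Integrable (S t) P) ∧
      Tendsto (fun t : ℝ≥0 => eLpNorm (fun ω => S t ω / f t - ∑ i : I, (i : ℝ) * μ i) 1 P)
        atTop (𝓝 0) ∧
      ((∀ i, Summable (fun k : ℕ =>
          cumulativeRate (lam i) ((k : ℝ) + 1) ((k : ℝ) + 2) / f ((k : ℝ) + 1) ^ 2)) →
        ∀ᵐ ω ∂P, Tendsto (fun t : ℝ≥0 => S t ω / f t) atTop
          (𝓝 (∑ i : I, (i : ℝ) * μ i)))) ∧
    (∀ (m σ2 : I → ℝ≥0 → ℝ) (μ s2 : I → ℝ), (∀ i, 0 ≤ s2 i) →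
      (∀ i (t : ℝ≥0), cumulativeRate (lam i) 0 t = m i t + σ2 i t) →
      (∀ i, Tendsto (fun t : ℝ≥0 => m i t / √(f t)) atTop (𝓝 (μ i))) →
      (∀ i, Tendsto (fun t : ℝ≥0 => σ2 i t / f t) atTop (𝓝 (s2 i))) →
      Tendsto (fun t : ℝ≥0 => (∑ i : I, (i : ℝ) * σ2 i t) / √(f t)) atTop (𝓝 0) →
      TendstoInDistribution (fun (t : ℝ≥0) ω => S t ω / √(f t)) atTop (id : ℝ → ℝ)
        (fun _ => P)
        (gaussianReal (∑ i : I, (i : ℝ) * μ i)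
          (∑ i : I, (i : ℝ) ^ 2 * s2 i).toNNReal)) := by
  obtain ⟨-, N, hN, hind, hSN⟩ := hS
  have hSt : ∀ t, S t =ᵐ[P] fun ω => ∑ i : I, (i : ℝ) * (N i t ω : ℝ) := fun t => by
    filter_upwards [hSN] with ω hω using hω t
  have hftop' : Tendsto (fun t : ℝ≥0 => f t) atTop atTop :=
    hftop.comp (NNReal.tendsto_coe_atTop.2 tendsto_id)
  refine ⟨fun μ _ hΛ => ?_, fun m σ2 μ s2 hs2 hΛ hm hσ hbal => ?_⟩
  · have hint : ∀ t : ℝ≥0, Integrable (S t) P := fun t =>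
      (integrable_finsetSum _ fun i _ =>
        (((hN i).memLp t).integrable (by norm_num)).const_mul _).congr (hSt t).symm
    have hL1 : Tendsto (fun t : ℝ≥0 =>
        eLpNorm (fun ω => S t ω / f t - ∑ i : I, (i : ℝ) * μ i) 1 P) atTop (𝓝 0) := by
      refine (tendsto_eLpNorm_sum_const_mul (fun i : I => (i : ℝ))
        (Y := fun i (t : ℝ≥0) ω => (N i t ω : ℝ) / f t - μ i)
        (fun i t => ((((hN i).measurable_natCast t).div_const _).sub_const _).aestronglyMeasurable)
        fun i => (hN i).tendsto_eLpNorm_div_sub hftop' (hΛ i)).congr fun t => eLpNorm_congr_ae ?_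
      filter_upwards [hSt t] with ω hω
      rw [hω, Finset.sum_div, ← Finset.sum_sub_distrib]
      exact Finset.sum_congr rfl fun i _ => by ring
    refine ⟨tendstoInMeasure_of_tendsto_eLpNorm one_ne_zero
      (fun t => ((hint t).div_const _).aestronglyMeasurable) aestronglyMeasurable_const hL1,
      hint, hL1, fun hsum => ?_⟩
    have hall : ∀ᵐ ω ∂P, ∀ i, Tendsto (fun t : ℝ≥0 => (N i t ω : ℝ) / f t) atTop (𝓝 (μ i)) :=
      ae_all_iff.2 fun i => (hN i).ae_tendsto_div hfmono hftop (hΛ i) (hsum i)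
    filter_upwards [hall, hSN] with ω hω hSω
    refine (tendsto_finsetSum Finset.univ fun i _ => (hω i).const_mul (i : ℝ)).congr fun t => ?_
    rw [hSω, Finset.sum_div]
    exact Finset.sum_congr rfl fun i _ => by ring
  · have hg : Tendsto (fun t : ℝ≥0 => √(f t)) atTop atTop := Real.tendsto_sqrt_atTop.comp hftop'
    refine tendstoInDistribution_sum_poissonProcess hN hind hSt hg hs2 ?_ fun i => ?_
    -- The drift of order $\sqrt f$ from the $\sigma_i^2$ cancels only in the sum over $i$, so it is
    -- treated jointly.
    · have h := (tendsto_finsetSum Finset.univ fun i _ => (hm i).const_mul (i : ℝ)).add hbal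
      rw [add_zero] at h
      refine h.congr fun t => ?_
      rw [Finset.sum_div, ← Finset.sum_add_distrib]
      refine Finset.sum_congr rfl fun i _ => ?_
      rw [hΛ]
      ring
    -- At scale $f$ the part $m_i=O(\sqrt f)$ is negligible.
    · have h := ((hm i).div_atTop hg).add (hσ i)
      rw [zero_add] at h
      refine h.congr fun t => ?_
      rw [hΛ, div_div, Real.mul_self_sqrt (hf0 t t.coe_nonneg),
        Real.sq_sqrt (hf0 t t.coe_nonneg), add_div]
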